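/- For natural numbers $m,k$ with $1\le k\le m-1$, let $\sigma(m,k)$ be the orbit dimension of the symmetric group $G=\mathrm{Sym}(m)$ in its natural action on the set $\Omega$ of $k$-element subsets of $\{1,\ldots,m\}$; that is, $\sigma(m,k)$ is the minimum cardinality of a subset $S\subseteq\Omega$ such that, for any two distinct $\omega,\omega'\in\Omega$, there exists $\alpha\in S$ for which $\omega$ and $\omega'$ lie in distinct orbits of the stabilizer $G_\alpha$. Theorem. Let $m\ge 4$ be an integer and let $q,r$ be non-negative integers with $m=13q+r$ and $0\le r<13$. Then $$\frac{36m-50}{59}\le \sigma(m,3)\le 8q+2r\le \frac{8m}{13}+24 .$$ -/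

import Mathlib

namespace OrbitDim

/-- `α` separates `ω` and `ω'` when they lie in distinct orbits of the stabilizer of `α`. -/
def Separates (G : Type*) {Ω : Type*} [Group G] [MulAction G Ω] (α ω ω' : Ω) : Prop :=
  MulAction.orbit (MulAction.stabilizer G α) ω ≠ MulAction.orbit (MulAction.stabilizer G α) ω'

/-- A set of points is separating when any two distinct points are separated by one of its
elements. -/
def IsSeparating (G : Type*) {Ω : Type*} [Group G] [MulAction G Ω] (S : Finset Ω) : Prop :=
  ∀ ω ω' : Ω, ω ≠ ω' → ∃ α ∈ S, Separates G α ω ω'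

/-- The orbit dimension of a group acting on a finite set: the minimum cardinality of a
separating set. The minimum is over a nonempty set of natural numbers,
see `exists_isSeparating`. -/
noncomputable def orbitDimension (G Ω : Type*) [Group G] [MulAction G Ω] [Finite Ω] : ℕ :=
  sInf {n : ℕ | ∃ S : Finset Ω, IsSeparating G S ∧ S.card = n}

theorem exists_isSeparating (G Ω : Type*) [Group G] [MulAction G Ω] [Finite Ω] :
    ∃ S : Finset Ω, IsSeparating G S := by
  have := Fintype.ofFinite Ω
  refine ⟨Finset.univ, fun ω ω' hne => ⟨ω, Finset.mem_univ ω, fun h => hne ?_⟩⟩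
  have hm : ω' ∈ MulAction.orbit (MulAction.stabilizer G ω) ω := by
    rw [h]
    exact MulAction.mem_orbit_self ω'
  obtain ⟨g, hg⟩ := hm
  exact (MulAction.mem_stabilizer_iff.mp g.2).symm.trans hg

/-- `σ(m, k)`: the orbit dimension of the symmetric group of degree `m` in its natural action on
the `k`-subsets of an `m`-element set. -/
noncomputable def sigma (m k : ℕ) : ℕ :=
  orbitDimension (Equiv.Perm (Fin m)) (Set.powersetCard (Fin m) k)

end OrbitDim

/-! A stabilizer of a triple `α` fails to separate two triples exactly when they meet `α` in equally
many points (`separates_iff`), so `sigma m 3` is the least size of a family of triples that resolves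
all triples by intersection sizes.

Upper bound: if `A` and `B` are not separated, the difference of their indicators sums to zero on
every chosen triple and has equally many values 1 and -1, at most three of each. Blocks of 13, 14
and 26 points carry 8, 10 and 16 triples such that any such function is zero or unbalanced on the
block. In a disjoint union at most one block has threshold 3 and the others 4; as 3 + 4 > 6, only
one block can be nonzero, and imbalance there is a contradiction (`sigma_le_of_tripleGadget`).

Lower bound: discharging on the 3-uniform hypergraph of chosen triples. Each edge gives at most 59
to its vertices (`Resolves.sum_charge_le`), and each vertex receives at least 36 (`le_sum_charge`),
apart from at most one isolated vertex (deficit 36) and at most one degree-two vertex with both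
edges pendant (deficit 14). The deficits add up to 50. -/

namespace OrbitDim

open Finset
open scoped Pointwise

/-! ### Separation in terms of intersection sizes -/

section Orbits

variable {m : ℕ}

/-- A bijection preserving two subsets exists as soon as the intersections have equal size. -/
theorem exists_perm_smul_eq {α : Type*} [Fintype α] [DecidableEq α] {e A B : Finset α}
    (hAB : #A = #B) (h : #(e ∩ A) = #(e ∩ B)) :
    ∃ g : Equiv.Perm α, e.image g = e ∧ A.image g = B := by
  classical
  -- The labels cut out the four Venn regions of `e` with `A`, and with `B`; corresponding regions
  -- have equal size, so gluing bijections between them gives `g`.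
  let f : α → Bool × Bool := fun v => (decide (v ∈ e), decide (v ∈ A))
  let f' : α → Bool × Bool := fun v => (decide (v ∈ e), decide (v ∈ B))
  have key : ∀ c, Nonempty ({a // f a = c} ≃ {a // f' a = c}) := by
    intro c
    rw [← Fintype.card_eq, Fintype.card_subtype, Fintype.card_subtype]
    have e1 := card_inter_add_card_sdiff e A
    have e2 := card_inter_add_card_sdiff e B
    have e3 := card_inter_add_card_sdiff A e
    have e4 := card_inter_add_card_sdiff B e
    have e5 := card_union_add_card_inter e A
    have e6 := card_union_add_card_inter e B
    have e7 := card_add_card_compl (e ∪ A)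
    have e8 := card_add_card_compl (e ∪ B)
    rw [inter_comm] at e3 e4
    obtain ⟨b1, b2⟩ := c
    cases b1 <;> cases b2
    · rw [show filter (fun x => f x = (false, false)) univ = (e ∪ A)ᶜ by
        ext; simp [f], show filter (fun x => f' x = (false, false)) univ = (e ∪ B)ᶜ by
        ext; simp [f']]
      omega
    · rw [show filter (fun x => f x = (false, true)) univ = A \ e by
        ext; simp [f, and_comm], show filter (fun x => f' x = (false, true)) univ = B \ e by
        ext; simp [f', and_comm]]
      omega
    · rw [show filter (fun x => f x = (true, false)) univ = e \ A by
        ext; simp [f], show filter (fun x => f' x = (true, false)) univ = e \ B by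
        ext; simp [f']]
      omega
    · rw [show filter (fun x => f x = (true, true)) univ = e ∩ A by
        ext; simp [f], show filter (fun x => f' x = (true, true)) univ = e ∩ B by
        ext; simp [f']]
      omega
  let g : Equiv.Perm α := Equiv.ofFiberEquiv (fun c => (key c).some)
  have hg : ∀ a, f' (g a) = f a := fun a => Equiv.ofFiberEquiv_map _ a
  have hg1 : ∀ a, g a ∈ e ↔ a ∈ e := fun a => by
    simpa [f, f'] using congrArg Prod.fst (hg a)
  have hg2 : ∀ a, g a ∈ B ↔ a ∈ A := fun a => by
    simpa [f, f'] using congrArg Prod.snd (hg a)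
  refine ⟨g, ?_, ?_⟩
  · ext x
    rw [mem_image]
    exact ⟨by rintro ⟨a, ha, rfl⟩; exact (hg1 a).2 ha,
      fun hx => ⟨g.symm x, (hg1 _).1 (by simpa using hx), by simp⟩⟩
  · ext x
    rw [mem_image]
    exact ⟨by rintro ⟨a, ha, rfl⟩; exact (hg2 a).2 ha,
      fun hx => ⟨g.symm x, (hg2 _).1 (by simpa using hx), by simp⟩⟩

theorem separates_iff {k : ℕ} (a b c : Set.powersetCard (Fin m) k) :
    Separates (Equiv.Perm (Fin m)) a b c ↔
      #((a : Finset (Fin m)) ∩ b) ≠ #((a : Finset (Fin m)) ∩ c) := by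
  rw [Separates, not_iff_not]
  constructor
  · intro h
    have hc : b ∈ MulAction.orbit (MulAction.stabilizer (Equiv.Perm (Fin m)) a) c := by
      rw [← h]
      exact MulAction.mem_orbit_self b
    obtain ⟨⟨g, hg⟩, rfl⟩ := hc
    have hg' : g • (a : Finset (Fin m)) = a := by
      rw [← Set.powersetCard.coe_smul, MulAction.mem_stabilizer_iff.mp hg]
    have : ((⟨g, hg⟩ : MulAction.stabilizer (Equiv.Perm (Fin m)) a) • c :
        Set.powersetCard (Fin m) k) = g • c := rfl
    simp only [this, Set.powersetCard.coe_smul]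
    nth_rewrite 1 [← hg']
    rw [← smul_finset_inter, card_smul_finset]
  · intro h
    obtain ⟨g, h1, h2⟩ := exists_perm_smul_eq
      ((Set.powersetCard.card_eq b).trans (Set.powersetCard.card_eq c).symm) h
    have hg : g ∈ MulAction.stabilizer (Equiv.Perm (Fin m)) a := by
      rw [MulAction.mem_stabilizer_iff]
      apply Subtype.ext
      exact h1
    rw [eq_comm, MulAction.orbit_eq_iff]
    exact ⟨⟨g, hg⟩, Subtype.ext h2⟩

end Orbits

/-! ### Upper bound: gluing blocks of triples -/

section Gadgets

/-- There are at most `N` triples in `{0, …, m - 1}` such that every `{-1, 0, 1}`-valued function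
with at most three values `1` and at most three values `-1` that sums to zero on all these triples
either vanishes on `{0, …, m - 1}` or is unbalanced there with at least `t` nonzero values. -/
def TripleGadget (t m N : ℕ) : Prop :=
  ∃ E : Finset (Finset ℕ), #E ≤ N ∧ (∀ e ∈ E, e ⊆ range m ∧ #e = 3) ∧
    ∀ c : ℕ → ℤ, (∀ v, c v = 0 ∨ c v = 1 ∨ c v = -1) → (∀ e ∈ E, ∑ v ∈ e, c v = 0) →
      Nat.count (fun v => c v = 1) m ≤ 3 → Nat.count (fun v => c v = -1) m ≤ 3 →
      (∀ v < m, c v = 0) ∨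
        (t ≤ Nat.count (fun v => c v = 1) m + Nat.count (fun v => c v = -1) m ∧
          Nat.count (fun v => c v = 1) m ≠ Nat.count (fun v => c v = -1) m)

theorem tripleGadget_zero (t : ℕ) : TripleGadget t 0 0 :=
  ⟨∅, by simp, by simp, fun c _ _ _ _ => Or.inl (by simp)⟩

theorem count_eq_zero_of_forall {c : ℕ → ℤ} {m : ℕ} (h : ∀ v < m, c v = 0) {x : ℤ} (hx : x ≠ 0) :
    Nat.count (fun v => c v = x) m = 0 := by
  rw [Nat.count_iff_forall_not]
  intro v hv
  rw [h v hv]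
  exact hx.symm

theorem forall_eq_zero_of_count {c : ℕ → ℤ} {m : ℕ} (hc : ∀ v, c v = 0 ∨ c v = 1 ∨ c v = -1)
    (hp : Nat.count (fun v => c v = 1) m = 0) (hn : Nat.count (fun v => c v = -1) m = 0) :
    ∀ v < m, c v = 0 := by
  rw [Nat.count_iff_forall_not] at hp hn
  intro v hv
  have := hc v
  have := hp v hv
  have := hn v hv
  tauto

/-- Disjoint unions of gadgets. -/
theorem TripleGadget.add {m₁ m₂ N₁ N₂ : ℕ} (h₁ : TripleGadget 3 m₁ N₁)
    (h₂ : TripleGadget 4 m₂ N₂) : TripleGadget 3 (m₁ + m₂) (N₁ + N₂) := by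
  obtain ⟨E₁, a1, a2, a3⟩ := h₁
  obtain ⟨E₂, b1, b2, b3⟩ := h₂
  refine ⟨E₁ ∪ E₂.image (fun e => e.map (addLeftEmbedding m₁)), ?_, ?_, ?_⟩
  · exact (card_union_le _ _).trans (Nat.add_le_add a1 (card_image_le.trans b1))
  · intro e he
    rw [mem_union, mem_image] at he
    rcases he with he | ⟨e, he, rfl⟩
    · exact ⟨(a2 e he).1.trans (range_mono (Nat.le_add_right _ _)), (a2 e he).2⟩
    · refine ⟨fun x hx => ?_, by rw [card_map, (b2 e he).2]⟩
      rw [mem_map] at hx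
      obtain ⟨y, hy, rfl⟩ := hx
      have := mem_range.1 ((b2 e he).1 hy)
      rw [mem_range, addLeftEmbedding_apply]
      omega
  · intro c hc he hp hn
    rw [Nat.count_add] at hp hn
    rw [Nat.count_add, Nat.count_add]
    have k1 := a3 c hc (fun e h => he e (mem_union_left _ h)) (by omega) (by omega)
    have k2 := b3 (fun v => c (m₁ + v)) (fun v => hc _) (fun e h => by
      simpa using he _ (mem_union_right _ (mem_image_of_mem _ h))) (by omega) (by omega)
    rcases k2 with k2 | ⟨k2, k3⟩
    · have z1 := count_eq_zero_of_forall (c := fun v => c (m₁ + v)) k2 (one_ne_zero)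
      have z2 := count_eq_zero_of_forall (c := fun v => c (m₁ + v)) k2 (x := -1) (by decide)
      rw [z1, z2]
      rcases k1 with k1 | k1
      · left
        intro v hv
        rcases lt_or_ge v m₁ with h | h
        · exact k1 v h
        · have := k2 (v - m₁) (by omega)
          rwa [show m₁ + (v - m₁) = v by omega] at this
      · right
        exact k1
    · right
      rcases k1 with k1 | k1
      · have z1 := count_eq_zero_of_forall k1 (one_ne_zero)
        have z2 := count_eq_zero_of_forall k1 (x := -1) (by decide)
        rw [z1, z2]
        omega
      -- Both parts nonzero would need at least 3 + 4 nonzero values, but only six are allowed.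
      · omega

/-- Two or more further vertices cost at most two triples each. -/
theorem TripleGadget.extend {t m N r : ℕ} (h : TripleGadget t m N) (hr : 2 ≤ r)
    (hm : 4 ≤ m + r) : TripleGadget t (m + r) (N + 2 * r) := by
  obtain ⟨E, a1, a2, a3⟩ := h
  obtain ⟨k, hk⟩ : ∃ k, m + r = k + 4 := ⟨m + r - 4, by omega⟩
  rw [hk]
  have hsum : ∀ (c : ℕ → ℤ) {x y z : ℕ}, x < y → y < z →
      ∑ v ∈ ({x, y, z} : Finset ℕ), c v = c x + c y + c z := by
    intro c x y z h1 h2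
    rw [sum_insert (by simp; omega), sum_pair (by omega), add_assoc]
  have hcard : ∀ {x y z : ℕ}, x < y → y < z → #({x, y, z} : Finset ℕ) = 3 := by
    intro x y z h1 h2
    rw [card_insert_of_notMem (by simp; omega), card_pair (by omega)]
  -- All four triples on the last four points force `c` to vanish there; each remaining new point is
  -- tied to two of these zeros. For `r < 4` the quadruple reaches into the old points and the
  -- interval is empty: four triples suffice, and `4 ≤ 2 * r`.
  refine ⟨E ∪ ({{k, k + 1, k + 2}, {k, k + 1, k + 3}, {k, k + 2, k + 3}, {k + 1, k + 2, k + 3}} ∪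
    (Ico m k).image (fun w => {w, k + 2, k + 3})), ?_, ?_, ?_⟩
  · refine (card_union_le _ _).trans (Nat.add_le_add a1 ((card_union_le _ _).trans ?_))
    have h4 : #({{k, k + 1, k + 2}, {k, k + 1, k + 3}, {k, k + 2, k + 3},
      {k + 1, k + 2, k + 3}} : Finset (Finset ℕ)) ≤ 4 := card_le_four
    have h5 := card_image_le (s := Ico m k) (f := fun w => ({w, k + 2, k + 3} : Finset ℕ))
    rw [Nat.card_Ico] at h5
    omega
  · intro e he
    simp only [mem_union, mem_insert, mem_singleton, mem_image, mem_Ico] at he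
    rcases he with he | (rfl | rfl | rfl | rfl) | ⟨w, hw, rfl⟩
    · exact ⟨(a2 e he).1.trans (range_mono (by omega)), (a2 e he).2⟩
    all_goals
      refine ⟨?_, hcard (by omega) (by omega)⟩
      intro x hx
      simp only [mem_insert, mem_singleton] at hx
      rw [mem_range]
      omega
  · intro c hc he hp hn
    have e1 := he {k, k + 1, k + 2} (by simp)
    have e2 := he {k, k + 1, k + 3} (by simp)
    have e3 := he {k, k + 2, k + 3} (by simp)
    have e4 := he {k + 1, k + 2, k + 3} (by simp)
    rw [hsum c (by omega) (by omega)] at e1 e2 e3 e4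
    have new : ∀ v, m ≤ v → v < k + 4 → c v = 0 := by
      intro v h1 h2
      rcases lt_or_ge v k with h | h
      · have e5 := he {v, k + 2, k + 3} (mem_union_right _ (mem_union_right _
          (mem_image_of_mem _ (mem_Ico.2 ⟨h1, h⟩))))
        rw [hsum c (by omega) (by omega)] at e5
        omega
      · obtain rfl | rfl | rfl | rfl : v = k ∨ v = k + 1 ∨ v = k + 2 ∨ v = k + 3 := by omega
        all_goals omega
    rw [← hk] at hp hn new ⊢
    have z1 : Nat.count (fun v => c (m + v) = 1) r = 0 :=
      count_eq_zero_of_forall (c := fun v => c (m + v))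
        (fun v hv => new _ (by omega) (by omega)) one_ne_zero
    have z2 : Nat.count (fun v => c (m + v) = -1) r = 0 :=
      count_eq_zero_of_forall (c := fun v => c (m + v)) (x := -1)
        (fun v hv => new _ (by omega) (by omega)) (by decide)
    rw [Nat.count_add] at hp hn
    rw [Nat.count_add, Nat.count_add, z1, z2]
    rcases a3 c hc (fun e h => he e (mem_union_left _ h)) (by omega) (by omega) with k1 | k1
    · left
      intro v hv
      rcases lt_or_ge v m with h | h
      · exact k1 v h
      · exact new v h hv
    · exact Or.inr k1

theorem sigma_le_of_tripleGadget {m N : ℕ} (h : TripleGadget 3 m N) : sigma m 3 ≤ N := by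
  classical
  obtain ⟨E, h1, h2, h3⟩ := h
  let im : Set.powersetCard (Fin m) 3 → Finset ℕ := fun a => a.1.map Fin.valEmbedding
  have him : Function.Injective im := fun a b hab => Subtype.ext (map_injective _ hab)
  have hint : ∀ a b, #(im a ∩ im b) = #(a.1 ∩ b.1) := fun a b => by
    rw [← map_inter, card_map]
  have hrange : ∀ a, im a ⊆ range m := fun a x hx => by
    obtain ⟨y, -, rfl⟩ := mem_map.1 hx
    simp
  let S : Finset (Set.powersetCard (Fin m) 3) := univ.filter fun a => im a ∈ E
  have hS : #S ≤ N :=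
    (card_le_card_of_injOn im (by intro a ha; simpa [S] using ha) him.injOn).trans h1
  suffices hsep : IsSeparating (Equiv.Perm (Fin m)) S from
    le_trans (Nat.sInf_le (s := {n | ∃ S : Finset (Set.powersetCard (Fin m) 3),
      IsSeparating (Equiv.Perm (Fin m)) S ∧ #S = n}) ⟨S, hsep, rfl⟩) hS
  intro ω ω' hne
  by_contra hcon
  have hnot : ∀ a ∈ S, #(im a ∩ im ω) = #(im a ∩ im ω') := by
    intro a ha
    by_contra hh
    refine hcon ⟨a, ha, ?_⟩
    rw [separates_iff]
    rwa [hint, hint] at hh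
  have hcard : ∀ a, #(im a) = 3 := fun a => by rw [card_map]; exact Set.powersetCard.card_eq a
  refine hne (him ?_)
  generalize im ω = A, im ω' = B, hcard ω = hA, hcard ω' = hB, hrange ω = rA, hrange ω' = rB
    at hnot
  -- Since `A` and `B` have the same size, this function is balanced, which rules out the second
  -- alternative of the gadget.
  let c : ℕ → ℤ := fun v => (if v ∈ A then 1 else 0) - (if v ∈ B then 1 else 0)
  have c1 : ∀ v, c v = 1 ↔ v ∈ A \ B := fun v => by
    by_cases a : v ∈ A <;> by_cases b : v ∈ B <;> simp [c, a, b]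
  have c2 : ∀ v, c v = -1 ↔ v ∈ B \ A := fun v => by
    by_cases a : v ∈ A <;> by_cases b : v ∈ B <;> simp [c, a, b]
  have n1 : Nat.count (fun v => c v = 1) m = #(A \ B) := by
    rw [Nat.count_eq_card_filter_range]
    congr 1
    ext v
    rw [mem_filter, c1, and_iff_right_iff_imp]
    exact fun hv => rA (mem_sdiff.1 hv).1
  have n2 : Nat.count (fun v => c v = -1) m = #(B \ A) := by
    rw [Nat.count_eq_card_filter_range]
    congr 1
    ext v
    rw [mem_filter, c2, and_iff_right_iff_imp]
    exact fun hv => rB (mem_sdiff.1 hv).1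
  have d1 := card_inter_add_card_sdiff A B
  have d2 := card_inter_add_card_sdiff B A
  rw [inter_comm] at d2
  have hz := h3 c
    (fun v => by by_cases a : v ∈ A <;> by_cases b : v ∈ B <;> simp [c, a, b])
    (by
      intro e he
      have himg : (univ.filter fun v : Fin m => v.val ∈ e).map Fin.valEmbedding = e := by
        ext x
        simp only [mem_map, mem_filter, mem_univ, true_and, Fin.valEmbedding_apply]
        exact ⟨by rintro ⟨y, hy, rfl⟩; exact hy,
          fun hx => ⟨⟨x, mem_range.1 ((h2 e he).1 hx)⟩, hx, rfl⟩⟩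
      have hc3 : #(univ.filter fun v : Fin m => v.val ∈ e) = 3 := by
        rw [← card_map Fin.valEmbedding, himg, (h2 e he).2]
      have := hnot ⟨_, hc3⟩ (by simpa [S, im, himg] using he)
      simp only [im, himg] at this
      rw [sum_sub_distrib, sum_ite_mem, sum_ite_mem, sum_const, sum_const, this, sub_self])
    (by omega) (by omega)
  rcases hz with hz | hz
  · have : A ⊆ B := by
      intro v hv
      by_contra hb
      have := hz v (mem_range.1 (rA hv))
      rw [(c1 v).2 (mem_sdiff.2 ⟨hv, hb⟩)] at this
      exact one_ne_zero this
    exact eq_of_subset_of_card_le this (by omega)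
  · omega

/-! ### Verifying the blocks by exhaustive search -/

/-- Depth-first search for the functions in the definition of `TripleGadget`. The `k`-th entry
of `cons` lists the pairs of vertices below `k` that form a triple with `k`; `h` holds the values
already chosen, latest first, and `p`, `n` count those equal to `1` and `-1`. -/
def search (t : ℕ) : List (List (ℕ × ℕ)) → List ℤ → ℕ → ℕ → Bool
  | [], _, p, n => decide (p + n = 0 ∨ (t ≤ p + n ∧ p ≠ n))
  | es :: rest, h, p, n =>
    [((0 : ℤ), p, n), (1, p + 1, n), (-1, p, n + 1)].all fun x =>
      decide (3 < x.2.1) || decide (3 < x.2.2) ||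
      es.any (fun ab => decide (x.1 + h.getD (h.length - 1 - ab.1) 0 +
        h.getD (h.length - 1 - ab.2) 0 ≠ 0)) ||
      search t rest (x.1 :: h) x.2.1 x.2.2

/-- The values of `c` below `k`, latest first. -/
def history (c : ℕ → ℤ) : ℕ → List ℤ
  | 0 => []
  | k + 1 => c k :: history c k

theorem length_history (c : ℕ → ℤ) (k : ℕ) : (history c k).length = k := by
  induction k with
  | zero => rfl
  | succ k ih => simp [history, ih]

theorem history_getD (c : ℕ → ℤ) {k a : ℕ} (h : a < k) :
    (history c k).getD (k - 1 - a) 0 = c a := by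
  induction k with
  | zero => omega
  | succ k ih =>
    rcases Nat.lt_succ_iff_lt_or_eq.1 h with h | rfl
    · rw [show k + 1 - 1 - a = (k - 1 - a) + 1 by omega, history, List.getD_cons_succ, ih h]
    · simp [history]

/-- An admissible `c` traces one branch of the search tree that is never pruned, so the test at its
leaf applies to `c`. -/
theorem search_sound {t : ℕ} {c : ℕ → ℤ} (hc : ∀ v, c v = 0 ∨ c v = 1 ∨ c v = -1)
    (cons : List (List (ℕ × ℕ))) : ∀ k : ℕ,
    search t cons (history c k) (Nat.count (fun v => c v = 1) k)
      (Nat.count (fun v => c v = -1) k) = true →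
    (∀ x ∈ cons.zipIdx k, ∀ ab ∈ x.1, ab.1 < ab.2 ∧ ab.2 < x.2 ∧ c ab.1 + c ab.2 + c x.2 = 0) →
    Nat.count (fun v => c v = 1) (k + cons.length) ≤ 3 →
    Nat.count (fun v => c v = -1) (k + cons.length) ≤ 3 →
    Nat.count (fun v => c v = 1) (k + cons.length) +
        Nat.count (fun v => c v = -1) (k + cons.length) = 0 ∨
      (t ≤ Nat.count (fun v => c v = 1) (k + cons.length) +
          Nat.count (fun v => c v = -1) (k + cons.length) ∧
        Nat.count (fun v => c v = 1) (k + cons.length) ≠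
          Nat.count (fun v => c v = -1) (k + cons.length)) := by
  induction cons with
  | nil =>
    intro k hs _ _ _
    simpa [search] using hs
  | cons es rest ih =>
    intro k hs he hp hn
    rw [List.length_cons, show k + (rest.length + 1) = (k + 1) + rest.length by omega] at *
    have m1 := Nat.count_monotone (fun v => c v = 1) (Nat.le_add_right (k + 1) rest.length)
    have m2 := Nat.count_monotone (fun v => c v = -1) (Nat.le_add_right (k + 1) rest.length)
    refine ih (k + 1) ?_ (fun x hx => he x (by rw [List.zipIdx_cons]; exact .tail _ hx)) hp hn
    have hx : (c k, Nat.count (fun v => c v = 1) (k + 1), Nat.count (fun v => c v = -1) (k + 1)) ∈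
        [((0 : ℤ), Nat.count (fun v => c v = 1) k, Nat.count (fun v => c v = -1) k),
          (1, Nat.count (fun v => c v = 1) k + 1, Nat.count (fun v => c v = -1) k),
          (-1, Nat.count (fun v => c v = 1) k, Nat.count (fun v => c v = -1) k + 1)] := by
      rw [Nat.count_succ, Nat.count_succ]
      rcases hc k with h | h | h <;> simp [h]
    rw [search, List.all_eq_true] at hs
    have := hs _ hx
    simp only [Bool.or_eq_true, decide_eq_true_eq, length_history] at this
    rcases this with ((h | h) | h) | h
    · omega
    · omega
    · rw [List.any_eq_true] at h
      obtain ⟨ab, hab, h⟩ := h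
      obtain ⟨h1, h2, h3⟩ := he (es, k) (by rw [List.zipIdx_cons]; exact .head _) ab hab
      rw [history_getD c (h1.trans h2), history_getD c h2, decide_eq_true_eq] at h
      exact absurd (by linarith) h
    · exact h

/-- The triples described by a list of constraints as in `search`. -/
def triplesOf (cons : List (List (ℕ × ℕ))) : List (Finset ℕ) :=
  cons.zipIdx.flatMap fun x => x.1.map fun ab => {ab.1, ab.2, x.2}

theorem tripleGadget_of_search {t N : ℕ} (cons : List (List (ℕ × ℕ)))
    (hv : ∀ x ∈ cons.zipIdx, ∀ ab ∈ x.1, ab.1 < ab.2 ∧ ab.2 < x.2)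
    (hN : (triplesOf cons).length ≤ N) (hs : search t cons [] 0 0 = true) :
    TripleGadget t cons.length N := by
  refine ⟨(triplesOf cons).toFinset, (List.toFinset_card_le _).trans hN, ?_, ?_⟩
  · intro e he
    simp only [triplesOf, List.mem_toFinset, List.mem_flatMap, List.mem_map] at he
    obtain ⟨x, hx, ab, hab, rfl⟩ := he
    obtain ⟨h1, h2⟩ := hv x hx ab hab
    have h3 : x.2 < cons.length := by simpa using List.snd_lt_add_of_mem_zipIdx hx
    constructor
    · intro y hy
      simp only [mem_insert, mem_singleton] at hy
      rw [mem_range]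
      omega
    · rw [card_insert_of_notMem (by simp; omega), card_pair (by omega)]
  · intro c hc he hp hn
    have := search_sound (t := t) hc cons 0 (by simpa [history] using hs) (by
      intro x hx ab hab
      obtain ⟨h1, h2⟩ := hv x hx ab hab
      refine ⟨h1, h2, ?_⟩
      have := he {ab.1, ab.2, x.2} (by
        simp only [triplesOf, List.mem_toFinset, List.mem_flatMap, List.mem_map]
        exact ⟨x, hx, ab, hab, rfl⟩)
      rwa [sum_insert (by simp; omega), sum_pair (by omega), ← add_assoc] at this)
      (by simpa using hp) (by simpa using hn)
    rw [zero_add] at this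
    rcases this with h | h
    · exact Or.inl (forall_eq_zero_of_count hc (by omega) (by omega))
    · exact Or.inr h

theorem tripleGadget_thirteen : TripleGadget 3 13 8 :=
  tripleGadget_of_search [[], [], [(0, 1)], [], [(1, 3)], [(0, 3)], [(2, 5)], [], [(6, 7)],
    [(5, 7)], [], [(7, 10)], [(6, 10)]] (by decide) (by decide) (by decide +kernel)

theorem tripleGadget_fourteen : TripleGadget 4 14 10 :=
  tripleGadget_of_search [[], [], [(0, 1)], [(0, 1)], [], [(1, 4)], [(3, 5)], [(3, 4)], [(6, 7)],
    [], [(3, 9)], [(7, 9)], [(1, 4)], [(9, 12)]] (by decide) (by decide) (by decide +kernel)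

/-- Same density as the 13-point block, but with threshold 4, as repeated gluing by
`TripleGadget.add` requires. -/
theorem tripleGadget_twenty_six : TripleGadget 4 26 16 :=
  tripleGadget_of_search [[], [], [(0, 1)], [], [(0, 3)], [], [(0, 5)], [(1, 5)], [], [(5, 8)], [],
    [(8, 10)], [(3, 10)], [], [(8, 13)], [(7, 13)], [], [(10, 16)], [(15, 16)], [], [(16, 19)], [],
    [(13, 21)], [(19, 21)], [(12, 19)], [(21, 24)]] (by decide) (by decide) (by decide +kernel)

theorem TripleGadget.add_mul {m N : ℕ} (h : TripleGadget 3 m N) (j : ℕ) :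
    TripleGadget 3 (m + 26 * j) (N + 16 * j) := by
  induction j with
  | zero => exact h
  | succ j ih => exact ih.add tripleGadget_twenty_six

theorem tripleGadget_thirteen_mul (q : ℕ) : TripleGadget 3 (13 * q) (8 * q) := by
  rcases Nat.even_or_odd' q with ⟨j, rfl | rfl⟩
  · convert (tripleGadget_zero 3).add_mul j using 1 <;> ring
  · convert tripleGadget_thirteen.add_mul j using 1 <;> ring

theorem sigma_three_le {m q r : ℕ} (hm : 4 ≤ m) (hmqr : m = 13 * q + r) :
    sigma m 3 ≤ 8 * q + 2 * r := by
  subst hmqr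
  apply sigma_le_of_tripleGadget
  obtain rfl | rfl | hr : r = 0 ∨ r = 1 ∨ 2 ≤ r := by omega
  · exact tripleGadget_thirteen_mul q
  -- `4 ≤ m` excludes `q = 0`; one group of 13 points and the extra point are replaced by the
  -- 14-point block, costing 8 + 2 triples.
  · obtain ⟨q, rfl⟩ : ∃ n, q = n + 1 := ⟨q - 1, by omega⟩
    exact (tripleGadget_thirteen_mul q).add tripleGadget_fourteen
  · exact (tripleGadget_thirteen_mul q).extend hr hm

end Gadgets

/-! ### Lower bound: forbidden configurations -/

section Discharging

variable {α : Type*} [DecidableEq α]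

/-- Distinct triples are distinguished by the sizes of their intersections with the members
of `S`. -/
def Resolves (S : Finset (Finset α)) : Prop :=
  ∀ A B : Finset α, #A = 3 → #B = 3 → (∀ e ∈ S, #(e ∩ A) = #(e ∩ B)) → A = B

/-- The incidence function of a set system. -/
def inc (g : Finset α) (v : α) : ℕ := if v ∈ g then 1 else 0

/-- The members of `S` that contain `v`. -/
def star (S : Finset (Finset α)) (v : α) : Finset (Finset α) := S.filter (v ∈ ·)

/-- A member of `S` is pendant when it contains a vertex of degree one. -/
def Pendant (S : Finset (Finset α)) (e : Finset α) : Prop := ∃ p ∈ e, #(star S p) = 1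

/-- `v` has degree two and lies in the non-pendant edge `f` and in a pendant one. -/
def SemiPendant (S : Finset (Finset α)) (f : Finset α) (v : α) : Prop :=
  ∃ e, star S v = {e, f} ∧ Pendant S e ∧ ¬ Pendant S f

/-- A non-pendant edge that is adjacent to a pendant one through a vertex of degree two. -/
def NearPendant (S : Finset (Finset α)) (f : Finset α) : Prop := ∃ v, SemiPendant S f v

/-- `v` has degree two and its edge other than `h` is near-pendant. -/
def Linked (S : Finset (Finset α)) (h : Finset α) (v : α) : Prop :=
  ∃ f, h ≠ f ∧ star S v = {h, f} ∧ NearPendant S f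

/-- `v` has degree `d` and all its edges are pendant. -/
def FullyPendant (S : Finset (Finset α)) (d : ℕ) (v : α) : Prop :=
  #(star S v) = d ∧ ∀ e ∈ star S v, Pendant S e

variable {S : Finset (Finset α)}

theorem mem_star {v : α} {e : Finset α} : e ∈ star S v ↔ e ∈ S ∧ v ∈ e := mem_filter

theorem NearPendant.not_pendant {f : Finset α} (h : NearPendant S f) : ¬ Pendant S f := by
  obtain ⟨v, e, -, -, h⟩ := h
  exact h

theorem card_inter_triple (g : Finset α) {a b c : α} (hab : a ≠ b) (hac : a ≠ c) (hbc : b ≠ c) :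
    #(g ∩ {a, b, c}) = inc g a + inc g b + inc g c := by
  rw [inter_comm, ← filter_mem_eq_inter, card_filter, sum_insert (by simp [hab, hac]),
    sum_pair hbc, ← add_assoc]
  rfl

theorem Resolves.triple (hS : Resolves S) {a b c a' b' c' : α} (hab : a ≠ b) (hac : a ≠ c)
    (hbc : b ≠ c) (hab' : a' ≠ b') (hac' : a' ≠ c') (hbc' : b' ≠ c')
    (h : ∀ g ∈ S, inc g a + inc g b + inc g c = inc g a' + inc g b' + inc g c') :
    a = a' ∨ a = b' ∨ a = c' := by
  have := hS {a, b, c} {a', b', c'} (card_eq_three.2 ⟨_, _, _, hab, hac, hbc, rfl⟩)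
    (card_eq_three.2 ⟨_, _, _, hab', hac', hbc', rfl⟩) (fun g hg => by
      rw [card_inter_triple g hab hac hbc, card_inter_triple g hab' hac' hbc', h g hg])
  have ha : a ∈ ({a, b, c} : Finset α) := by simp
  rw [this] at ha
  simpa using ha

/-- Pad both pairs with a common point outside them; a fifth point guarantees that one exists. -/
theorem Resolves.pair [Fintype α] (hS : Resolves S) (hα : 5 ≤ Fintype.card α) {a b a' b' : α}
    (hab : a ≠ b) (hab' : a' ≠ b') (h : ∀ g ∈ S, inc g a + inc g b = inc g a' + inc g b') :
    a = a' ∨ a = b' := by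
  obtain ⟨x, hx⟩ : ∃ x, x ∉ ({a, b, a', b'} : Finset α) := by
    by_contra! hx
    have := card_le_card (fun x _ => hx x : (univ : Finset α) ⊆ {a, b, a', b'})
    have := card_le_four (a := a) (b := b) (c := a') (d := b')
    rw [card_univ] at *
    omega
  simp only [mem_insert, mem_singleton, not_or] at hx
  obtain ⟨h1, h2, h3, h4⟩ := hx
  rcases hS.triple hab (Ne.symm h1) (Ne.symm h2) hab' (Ne.symm h3) (Ne.symm h4)
    (fun g hg => by rw [h g hg]) with h | h | h
  · exact Or.inl h
  · exact Or.inr h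
  · exact absurd h.symm h1

theorem Resolves.inj [Fintype α] (hS : Resolves S) (hα : 4 ≤ Fintype.card α) {a a' : α}
    (h : ∀ g ∈ S, inc g a = inc g a') : a = a' := by
  obtain ⟨T, hT, hT'⟩ := exists_subset_card_eq (s := univ \ {a, a'}) (n := 2) (by
    have h1 := le_card_sdiff ({a, a'} : Finset α) univ
    have h2 := card_le_two (a := a) (b := a')
    rw [card_univ] at h1
    omega)
  obtain ⟨x, y, hxy, rfl⟩ := card_eq_two.1 hT'
  have hx := hT (mem_insert_self x {y})
  have hy := hT (mem_insert_of_mem (mem_singleton_self y))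
  simp only [mem_sdiff, mem_univ, mem_insert, mem_singleton, not_or, true_and] at hx hy
  rcases hS.triple (Ne.symm hx.1) (Ne.symm hy.1) hxy (Ne.symm hx.2) (Ne.symm hy.2) hxy
    (fun g hg => by rw [h g hg]) with h | h | h
  · exact h
  · exact absurd h.symm hx.1
  · exact absurd h.symm hy.1

theorem inc_of_star_eq {v : α} {T : Finset (Finset α)} (h : star S v = T) {g : Finset α}
    (hg : g ∈ S) : inc g v = ∑ e ∈ T, if g = e then 1 else 0 := by
  rw [sum_ite_eq, ← h]
  simp [inc, mem_star, hg]

theorem inc_of_star_eq_empty {v : α} (h : star S v = ∅) {g : Finset α} (hg : g ∈ S) :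
    inc g v = 0 := by
  rw [inc_of_star_eq h hg, sum_empty]

theorem inc_of_star_eq_singleton {v : α} {e : Finset α} (h : star S v = {e}) {g : Finset α}
    (hg : g ∈ S) : inc g v = if g = e then 1 else 0 := by
  rw [inc_of_star_eq h hg, sum_singleton]

theorem inc_of_star_eq_pair {v : α} {e f : Finset α} (h : star S v = {e, f}) (hef : e ≠ f)
    {g : Finset α} (hg : g ∈ S) :
    inc g v = (if g = e then 1 else 0) + if g = f then 1 else 0 := by
  rw [inc_of_star_eq h hg, sum_pair hef]

theorem inc_of_star_eq_triple {v : α} {e f k : Finset α} (h : star S v = {e, f, k}) (hef : e ≠ f)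
    (hek : e ≠ k) (hfk : f ≠ k) {g : Finset α} (hg : g ∈ S) :
    inc g v = (if g = e then 1 else 0) + ((if g = f then 1 else 0) + if g = k then 1 else 0) := by
  rw [inc_of_star_eq h hg, sum_insert (by simp [hef, hek]), sum_pair hfk]

theorem Pendant.exists_star_eq {e : Finset α} (h : Pendant S e) (he : e ∈ S) :
    ∃ p, star S p = {e} := by
  obtain ⟨p, hp, h1⟩ := h
  obtain ⟨e', h2⟩ := card_eq_one.1 h1
  have : e ∈ star S p := mem_star.2 ⟨he, hp⟩
  rw [h2, mem_singleton] at this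
  exact ⟨p, this ▸ h2⟩

theorem mem_of_star_eq {v : α} {T : Finset (Finset α)} (h : star S v = T) {e : Finset α}
    (he : e ∈ T) : e ∈ S ∧ v ∈ e := by
  rw [← h] at he
  exact mem_star.1 he

theorem ne_of_star_ne {v w : α} {T U : Finset (Finset α)} (hv : star S v = T) (hw : star S w = U)
    (h : T ≠ U) : v ≠ w := by
  rintro rfl
  exact h (hv.symm.trans hw)

theorem ne_of_card_star_ne {v w : α} {T U : Finset (Finset α)} (hv : star S v = T)
    (hw : star S w = U) (h : #T ≠ #U) : v ≠ w :=
  ne_of_star_ne hv hw fun h' => h (h' ▸ rfl)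

theorem Pendant.ne_of_not_pendant {f : Finset α} {e : Finset α} (he : Pendant S e) (hf : ¬ Pendant S f) :
    e ≠ f := by
  rintro rfl
  exact hf he

theorem Resolves.eq_of_leaf [Fintype α] (hS : Resolves S) (hα : 4 ≤ Fintype.card α)
    {e : Finset α} (he : e ∈ S) {v w : α} (hv : v ∈ e) (hw : w ∈ e) (h1 : #(star S v) = 1)
    (h2 : #(star S w) = 1) : v = w := by
  obtain ⟨a, ha⟩ := card_eq_one.1 h1
  obtain ⟨b, hb⟩ := card_eq_one.1 h2
  have hea : e ∈ star S v := mem_star.2 ⟨he, hv⟩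
  have heb : e ∈ star S w := mem_star.2 ⟨he, hw⟩
  rw [ha, mem_singleton] at hea
  rw [hb, mem_singleton] at heb
  subst hea heb
  exact hS.inj hα fun g hg => by
    rw [inc_of_star_eq_singleton ha hg, inc_of_star_eq_singleton hb hg]

theorem Resolves.eq_of_isolated [Fintype α] (hS : Resolves S) (hα : 4 ≤ Fintype.card α)
    {v w : α} (h1 : star S v = ∅) (h2 : star S w = ∅) : v = w :=
  hS.inj hα fun g hg => by rw [inc_of_star_eq_empty h1 hg, inc_of_star_eq_empty h2 hg]

/-- With leaves `p` of `e` and `p'` of `e'`, both `{v, p'}` and `{w, p}` have total incidence `e + f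
+ e'`. -/
theorem Resolves.eq_of_semiPendant [Fintype α] (hS : Resolves S) (hα : 5 ≤ Fintype.card α)
    {f : Finset α} {v w : α} (hv : SemiPendant S f v) (hw : SemiPendant S f w) : v = w := by
  obtain ⟨e, he, hep, hf⟩ := hv
  obtain ⟨e', he', hep', -⟩ := hw
  have hef := Pendant.ne_of_not_pendant hep hf
  have hef' := Pendant.ne_of_not_pendant hep' hf
  obtain ⟨p, hp⟩ := hep.exists_star_eq (mem_of_star_eq he (by simp)).1
  obtain ⟨p', hp'⟩ := hep'.exists_star_eq (mem_of_star_eq he' (by simp)).1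
  have n1 : v ≠ p' := ne_of_card_star_ne he hp' (by rw [card_pair hef, card_singleton]; decide)
  have n2 : w ≠ p := ne_of_card_star_ne he' hp (by rw [card_pair hef', card_singleton]; decide)
  have n3 : v ≠ p := ne_of_card_star_ne he hp (by rw [card_pair hef, card_singleton]; decide)
  rcases hS.pair hα n1 n2 (fun g hg => by
    rw [inc_of_star_eq_pair he hef hg, inc_of_star_eq_pair he' hef' hg,
      inc_of_star_eq_singleton hp hg, inc_of_star_eq_singleton hp' hg]
    ring) with h | h
  · exact h
  · exact absurd h n3

/-- Compare `v` plus the leaves of the edges at `w` with `w` plus the leaves of the edges at `v`. -/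
theorem Resolves.eq_of_fullyPendant_two (hS : Resolves S) {v w : α} (hv : FullyPendant S 2 v)
    (hw : FullyPendant S 2 w) : v = w := by
  obtain ⟨a, b, hab, hv2⟩ := card_eq_two.1 hv.1
  obtain ⟨c, d, hcd, hw2⟩ := card_eq_two.1 hw.1
  have leaf : ∀ {u : α} {T : Finset (Finset α)}, FullyPendant S 2 u → star S u = T → ∀ e ∈ T,
      ∃ p, star S p = {e} := fun hu hT e he =>
    (hu.2 e (hT ▸ he)).exists_star_eq (mem_of_star_eq hT he).1
  obtain ⟨pa, hpa⟩ := leaf hv hv2 a (by simp)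
  obtain ⟨pb, hpb⟩ := leaf hv hv2 b (by simp)
  obtain ⟨pc, hpc⟩ := leaf hw hw2 c (by simp)
  obtain ⟨pd, hpd⟩ := leaf hw hw2 d (by simp)
  have ne : ∀ {u p : α} {e f k : Finset α}, star S u = {e, f} → e ≠ f → star S p = {k} → u ≠ p :=
    fun h1 h2 h3 => ne_of_card_star_ne h1 h3 (by rw [card_pair h2, card_singleton]; decide)
  have ne' : ∀ {p r : α} {e f : Finset α}, star S p = {e} → star S r = {f} → e ≠ f → p ≠ r :=
    fun h1 h2 h3 => ne_of_star_ne h1 h2 (by simpa using h3)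
  rcases hS.triple (ne hv2 hab hpc) (ne hv2 hab hpd) (ne' hpc hpd hcd)
    (ne hw2 hcd hpa) (ne hw2 hcd hpb) (ne' hpa hpb hab) (fun g hg => by
      rw [inc_of_star_eq_pair hv2 hab hg, inc_of_star_eq_pair hw2 hcd hg,
        inc_of_star_eq_singleton hpa hg, inc_of_star_eq_singleton hpb hg,
        inc_of_star_eq_singleton hpc hg, inc_of_star_eq_singleton hpd hg]
      ring) with h | h | h
  · exact h
  · exact absurd h (ne hv2 hab hpa)
  · exact absurd h (ne hv2 hab hpb)

theorem exists_pair_of_card_three {T : Finset (Finset α)} {e : Finset α} (hT : #T = 3)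
    (he : e ∈ T) : ∃ a b, e ≠ a ∧ e ≠ b ∧ a ≠ b ∧ T = {e, a, b} := by
  have : #(T.erase e) = 2 := by rw [card_erase_of_mem he, hT]
  obtain ⟨a, b, hab, h⟩ := card_eq_two.1 this
  have h1 : e ∉ ({a, b} : Finset (Finset α)) := h ▸ notMem_erase e T
  simp only [mem_insert, mem_singleton, not_or] at h1
  exact ⟨a, b, h1.1, h1.2, hab, by rw [← h, insert_erase he]⟩

/-- The same exchange of leaves works: the common edge `e` contributes once to each side, so only
two leaves per side are needed. -/
theorem Resolves.eq_of_fullyPendant_three (hS : Resolves S) {e : Finset α} {v w : α}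
    (hev : e ∈ star S v) (hew : e ∈ star S w) (hv : FullyPendant S 3 v)
    (hw : FullyPendant S 3 w) : v = w := by
  obtain ⟨a, b, hea, heb, hab, hv2⟩ := exists_pair_of_card_three hv.1 hev
  obtain ⟨c, d, hec, hed, hcd, hw2⟩ := exists_pair_of_card_three hw.1 hew
  have leaf : ∀ {u : α} {T : Finset (Finset α)}, FullyPendant S 3 u → star S u = T → ∀ e ∈ T,
      ∃ p, star S p = {e} := fun hu hT e he =>
    (hu.2 e (hT ▸ he)).exists_star_eq (mem_of_star_eq hT he).1
  obtain ⟨pa, hpa⟩ := leaf hv hv2 a (by simp)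
  obtain ⟨pb, hpb⟩ := leaf hv hv2 b (by simp)
  obtain ⟨pc, hpc⟩ := leaf hw hw2 c (by simp)
  obtain ⟨pd, hpd⟩ := leaf hw hw2 d (by simp)
  have ne : ∀ {u p : α} {k : Finset α}, FullyPendant S 3 u → star S p = {k} → u ≠ p :=
    fun h1 h3 => ne_of_card_star_ne rfl h3 (by rw [h1.1, card_singleton]; decide)
  have ne' : ∀ {p r : α} {e f : Finset α}, star S p = {e} → star S r = {f} → e ≠ f → p ≠ r :=
    fun h1 h2 h3 => ne_of_star_ne h1 h2 (by simpa using h3)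
  rcases hS.triple (ne hv hpc) (ne hv hpd) (ne' hpc hpd hcd)
    (ne hw hpa) (ne hw hpb) (ne' hpa hpb hab) (fun g hg => by
      rw [inc_of_star_eq_triple hv2 hea heb hab hg, inc_of_star_eq_triple hw2 hec hed hcd hg,
        inc_of_star_eq_singleton hpa hg, inc_of_star_eq_singleton hpb hg,
        inc_of_star_eq_singleton hpc hg, inc_of_star_eq_singleton hpd hg]
      ring) with h | h | h
  · exact h
  · exact absurd h (ne hv hpa)
  · exact absurd h (ne hv hpb)

/-- Follow `h`, `f`, `e` from `x` to a leaf `p`, and `h`, `f'`, `e'` from `y` to a leaf `p'`. The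
triples `{x, u', p}` and `{y, u, p'}` both have total incidence `h + f + e + f' + e'`. -/
theorem Resolves.eq_of_linked (hS : Resolves S) {h : Finset α} (hh : ¬ Pendant S h) {x y : α}
    (hx : Linked S h x) (hy : Linked S h y) : x = y := by
  obtain ⟨f, hhf, hxs, hf⟩ := hx
  obtain ⟨f', hhf', hys, hf'⟩ := hy
  have hfn := hf.not_pendant
  have hfn' := hf'.not_pendant
  obtain ⟨u, e, hus, hep, -⟩ := hf
  obtain ⟨u', e', hus', hep', -⟩ := hf'
  have hef := Pendant.ne_of_not_pendant hep hfn
  have hef' := Pendant.ne_of_not_pendant hep' hfn'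
  obtain ⟨p, hp⟩ := hep.exists_star_eq (mem_of_star_eq hus (by simp)).1
  obtain ⟨p', hp'⟩ := hep'.exists_star_eq (mem_of_star_eq hus' (by simp)).1
  have ne : ∀ {u p : α} {e f k : Finset α}, star S u = {e, f} → e ≠ f → star S p = {k} → u ≠ p :=
    fun h1 h2 h3 => ne_of_card_star_ne h1 h3 (by rw [card_pair h2, card_singleton]; decide)
  have ne' : ∀ {z w : α} {a b c d : Finset α}, star S z = {a, b} → star S w = {c, d} →
      ¬ Pendant S a → ¬ Pendant S b → Pendant S c → z ≠ w := by
    rintro z w a b c d h1 h2 ha hb hc rfl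
    have : c ∈ ({a, b} : Finset (Finset α)) := by rw [← h1, h2]; simp
    simp only [mem_insert, mem_singleton] at this
    rcases this with rfl | rfl
    · exact ha hc
    · exact hb hc
  rcases hS.triple (ne hxs hhf hp) (ne' hxs hus' hh hfn hep') (ne hus' hef' hp).symm
    (ne' hys hus hh hfn' hep) (ne hys hhf' hp') (ne hus hef hp') (fun g hg => by
      rw [inc_of_star_eq_pair hxs hhf hg, inc_of_star_eq_pair hys hhf' hg,
        inc_of_star_eq_pair hus hef hg, inc_of_star_eq_pair hus' hef' hg,
        inc_of_star_eq_singleton hp hg, inc_of_star_eq_singleton hp' hg]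
      ring) with h | h | h
  · exact h
  · exact absurd h (ne' hxs hus hh hfn hep)
  · exact absurd h (ne hxs hhf hp')

/-! ### Lower bound: discharging -/

open Classical in
/-- The share of the total charge `59` of the edge `e` that is given to its vertex `v`. -/
noncomputable def charge (S : Finset (Finset α)) (e : Finset α) (v : α) : ℕ :=
  if Pendant S e then 11 + (if #(star S v) = 1 then 25 else 0) +
    (if FullyPendant S 3 v then 1 else 0)
  else if NearPendant S e then 16 + (if SemiPendant S e v then 9 else 0) +
    (if Linked S e v then 2 else 0)
  else 18 + (if Linked S e v then 2 else 0)

theorem sum_ite_le_of_subsingleton {β : Type*} (e : Finset β) (P : β → Prop) [DecidablePred P] (k : ℕ)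
    (h : ∀ v ∈ e, ∀ w ∈ e, P v → P w → v = w) : ∑ v ∈ e, (if P v then k else 0) ≤ k := by
  rw [← sum_filter, sum_const, smul_eq_mul]
  have : #(e.filter P) ≤ 1 := card_le_one.2 fun v hv w hw => by
    rw [mem_filter] at hv hw
    exact h v hv.1 w hw.1 hv.2 hw.2
  nlinarith

/-- Each bonus is paid at most once per edge, by the uniqueness lemmas. The totals are 33 + 25 + 1
for pendant edges, 48 + 9 + 2 for near-pendant ones and 54 + 2 for the rest. -/
theorem Resolves.sum_charge_le [Fintype α] (hS : Resolves S) (hα : 5 ≤ Fintype.card α)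
    {e : Finset α} (he : e ∈ S) (h3 : #e = 3) : ∑ v ∈ e, charge S e v ≤ 59 := by
  classical
  unfold charge
  by_cases h1 : Pendant S e
  · simp only [h1, if_true, sum_add_distrib, sum_const, h3, smul_eq_mul]
    have k1 := sum_ite_le_of_subsingleton e (fun v => #(star S v) = 1) 25
      fun v hv w hw a b => hS.eq_of_leaf (by omega) he hv hw a b
    have k2 := sum_ite_le_of_subsingleton e (FullyPendant S 3) 1
      fun v hv w hw a b => hS.eq_of_fullyPendant_three
        (mem_star.2 ⟨he, hv⟩) (mem_star.2 ⟨he, hw⟩) a b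
    omega
  · have k2 := sum_ite_le_of_subsingleton e (Linked S e) 2
      fun v _ w _ a b => hS.eq_of_linked h1 a b
    by_cases h2 : NearPendant S e
    · simp only [h1, h2, if_true, if_false, sum_add_distrib, sum_const, h3, smul_eq_mul]
      have k1 := sum_ite_le_of_subsingleton e (SemiPendant S e) 9
        fun v _ w _ a b => hS.eq_of_semiPendant hα a b
      omega
    · simp only [h1, h2, if_false, sum_add_distrib, sum_const, h3, smul_eq_mul]
      omega

theorem le_charge (e : Finset α) (v : α) : 11 ≤ charge S e v := by
  unfold charge
  split_ifs <;> omega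

theorem le_charge_of_not_pendant {e : Finset α} (he : ¬ Pendant S e) (v : α) :
    16 ≤ charge S e v := by
  unfold charge
  split_ifs <;> omega

theorem le_charge_add_charge {e f : Finset α} {v : α} (hef : e ≠ f) (hv : star S v = {e, f})
    (he : ¬ Pendant S e) : 36 ≤ charge S e v + charge S f v := by
  have hv' : star S v = {f, e} := by rw [hv, pair_comm]
  by_cases hf : Pendant S f
  · have h1 : SemiPendant S e v := ⟨f, hv', hf, he⟩
    have h2 : NearPendant S e := ⟨v, h1⟩
    have : 25 ≤ charge S e v := by
      simp only [charge, he, h1, h2, if_true, if_false]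
      omega
    have := le_charge (S := S) f v
    omega
  · have h1 : NearPendant S f → Linked S e v := fun h => ⟨f, hef, hv, h⟩
    have h2 : NearPendant S e → Linked S f v := fun h => ⟨e, hef.symm, hv', h⟩
    -- The sums are 18 + 18 in all but the mixed case, which gives 16 + 20: a near-pendant edge
    -- keeps back 2 and its neighbour's link bonus makes up for it.
    by_cases h3 : NearPendant S e <;> by_cases h4 : NearPendant S f <;>
      simp only [charge, he, hf, h1, h2, h3, h4, if_true, if_false] <;> omega

-- By degree: a leaf gets 11 + 25; degree two is `le_charge_add_charge` unless both edges are
-- pendant, when 22 leaves a deficit of 14; degree three gets at least 3 · 12 or 16 + 2 · 11; degree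
-- four or more at least 44.
open Classical in
theorem le_sum_charge (v : α) :
    36 ≤ ∑ e ∈ star S v, charge S e v + (if star S v = ∅ then 36 else 0) +
      (if FullyPendant S 2 v then 14 else 0) := by
  have hlow : ∀ T : Finset (Finset α), #T * 11 ≤ ∑ e ∈ T, charge S e v := fun T =>
    card_nsmul_le_sum T _ 11 fun e _ => le_charge e v
  obtain h | h | h | h | h : #(star S v) = 0 ∨ #(star S v) = 1 ∨ #(star S v) = 2 ∨
    #(star S v) = 3 ∨ 4 ≤ #(star S v) := by omega
  · rw [if_pos (card_eq_zero.1 h)]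
    omega
  · obtain ⟨e, he⟩ := card_eq_one.1 h
    have hp : Pendant S e := ⟨v, (mem_of_star_eq he (by simp)).2, h⟩
    have : 36 ≤ charge S e v := by
      simp only [charge, hp, h, if_true]
      omega
    rw [he, sum_singleton]
    omega
  · obtain ⟨e, f, hef, hv⟩ := card_eq_two.1 h
    by_cases he : Pendant S e
    · by_cases hf : Pendant S f
      · have h2 : FullyPendant S 2 v := ⟨h, by simp [hv, he, hf]⟩
        have := hlow (star S v)
        rw [if_pos h2]
        omega
      · have := le_charge_add_charge hef.symm (hv.trans (pair_comm e f)) hf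
        rw [hv, sum_pair hef]
        omega
    · have := le_charge_add_charge hef hv he
      rw [hv, sum_pair hef]
      omega
  · by_cases hp : ∀ e ∈ star S v, Pendant S e
    · have : #(star S v) * 12 ≤ ∑ e ∈ star S v, charge S e v :=
        card_nsmul_le_sum _ _ 12 fun e he => by
          have h3 : FullyPendant S 3 v := ⟨h, hp⟩
          simp only [charge, hp e he, h3, if_true]
          omega
      omega
    · push Not at hp
      obtain ⟨e, he, hne⟩ := hp
      have h1 := le_charge_of_not_pendant hne v
      have h2 := hlow ((star S v).erase e)
      have h4 := add_sum_erase (star S v) (fun e => charge S e v) he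
      rw [card_erase_of_mem he] at h2
      omega
  · have := hlow (star S v)
    omega

theorem Resolves.card_le [Fintype α] (hS : Resolves S) (hα : 5 ≤ Fintype.card α)
    (h3 : ∀ e ∈ S, #e = 3) : 36 * Fintype.card α ≤ 59 * #S + 50 := by
  classical
  have h1 : ∑ e ∈ S, ∑ v ∈ e, charge S e v = ∑ v : α, ∑ e ∈ star S v, charge S e v :=
    sum_comm' (by intro e v; simp [mem_star])
  have h2 : ∑ e ∈ S, ∑ v ∈ e, charge S e v ≤ ∑ _e ∈ S, 59 :=
    sum_le_sum fun e he => hS.sum_charge_le hα he (h3 e he)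
  have h4 := sum_le_sum fun (v : α) (_ : v ∈ univ) => le_sum_charge (S := S) v
  rw [sum_add_distrib, sum_add_distrib] at h4
  have h5 := sum_ite_le_of_subsingleton univ (fun v => star S v = ∅) 36
    fun v _ w _ a b => hS.eq_of_isolated (by omega) a b
  have h6 := sum_ite_le_of_subsingleton univ (FullyPendant S 2) 14
    fun v _ w _ a b => hS.eq_of_fullyPendant_two a b
  simp only [sum_const, smul_eq_mul, card_univ] at h2 h4
  omega

theorem Resolves.card_le_two_pow [Fintype α] (hS : Resolves S) (hα : 4 ≤ Fintype.card α) :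
    Fintype.card α ≤ 2 ^ #S := by
  rw [← card_powerset, ← card_univ]
  refine card_le_card_of_injOn (star S) (fun v _ => ?_) fun v _ w _ h => ?_
  · exact mem_coe.2 (mem_powerset.2 (filter_subset _ _))
  · exact hS.inj hα fun g hg => by
      rw [inc_of_star_eq h hg, inc_of_star_eq rfl hg]

theorem le_sigma_three {m : ℕ} (hm : 4 ≤ m) : 36 * m ≤ 59 * sigma m 3 + 50 := by
  obtain ⟨S₀, hS₀⟩ := exists_isSeparating (Equiv.Perm (Fin m)) (Set.powersetCard (Fin m) 3)
  obtain ⟨S, hS, hcard⟩ := Nat.sInf_mem (s := {n | ∃ S : Finset (Set.powersetCard (Fin m) 3),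
    IsSeparating (Equiv.Perm (Fin m)) S ∧ #S = n})
    ⟨_, S₀, hS₀, rfl⟩
  have hsig : #S = sigma m 3 := hcard
  have hT : #(S.image Subtype.val) = #S := card_image_of_injective S Subtype.val_injective
  have hres : Resolves (S.image Subtype.val) := by
    intro A B hA hB h
    by_contra hne
    obtain ⟨a, ha, hsep⟩ := hS ⟨A, hA⟩ ⟨B, hB⟩ fun h => hne (congrArg Subtype.val h)
    rw [separates_iff] at hsep
    exact hsep (h a.1 (mem_image_of_mem _ ha))
  -- Discharging needs five points. For `m = 4`, distinct points have distinct stars, so the family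
  -- has at least two members, which suffices.
  rcases hm.eq_or_lt with rfl | hm
  · have := hres.card_le_two_pow (by simp)
    rw [Fintype.card_fin, hT, hsig] at this
    have h2 : 2 ≤ sigma 4 3 := (Nat.pow_le_pow_iff_right (by norm_num : 1 < 2)).1 this
    omega
  · have := hres.card_le (by rw [Fintype.card_fin]; exact hm) (by
      intro e he
      obtain ⟨a, -, rfl⟩ := mem_image.1 he
      exact Set.powersetCard.card_eq a)
    rwa [Fintype.card_fin, hT, hsig] at this

end Discharging

end OrbitDim


theorem theorem1p3 (m q r : ℕ) (hm : 4 ≤ m) (hmqr : m = 13 * q + r) (hr : r < 13) :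
    (36 * (m : ℝ) - 50) / 59 ≤ (OrbitDim.sigma m 3 : ℝ) ∧
      OrbitDim.sigma m 3 ≤ 8 * q + 2 * r ∧
      8 * (q : ℝ) + 2 * (r : ℝ) ≤ 8 * (m : ℝ) / 13 + 24 := by
  refine ⟨?_, OrbitDim.sigma_three_le hm hmqr, ?_⟩
  · have h : (36 : ℝ) * m ≤ 59 * OrbitDim.sigma m 3 + 50 := by
      exact_mod_cast OrbitDim.le_sigma_three hm
    linarith
  · have hm' : (m : ℝ) = 13 * q + r := by exact_mod_cast hmqr
    have hr' : (r : ℝ) ≤ 12 := by exact_mod_cast Nat.lt_succ_iff.1 hr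
    linarith
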